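/- Fix a universal Turing machine $U$ (a partial recursive map $(p,y)\mapsto U(p,y)$ such that for every partial recursive $V$ there is a constant $c$ such that each program $p$ has a program $q$ with $l(q)\le l(p)+c$ and $U(q,\cdot)=V(p,\cdot)$, where $l$ denotes length). Let $C(x\mid y)$ denote the length of a shortest binary program that computes the binary string $x$ on input $y$ (conditional Kolmogorov complexity with respect to $U$). For a labeled graph $G$ on $n$ nodes let $E(G)$ be the binary string of length $\binom n2$ whose bits tell, for the pairs of nodes in lexicographic order, whether the pair is an edge of $G$; for a function $\delta$ call $G$ $\delta(n)$-random if $C(E(G)\mid n)\ge\binom n2-\delta(n)$. Let $\delta:\mathbb N\to\mathbb R$ satisfy $\delta(n)=o(n)$. Then there is a function $\varepsilon(n)=o(n)$ such that, for every $n$, every $\delta(n)$-random labeled graph $G$ on $n$ nodes and every two distinct nodes $i\neq j$ of $G$, the maximal number $r$ of paths of length $2$ between $i$ and $j$ that are pairwise node-disjoint apart from their end nodes satisfies $|r-n/4|\le\varepsilon(n)$. In particular, there is an $N$ such that for all $n\ge N$ every $\delta(n)$-random labeled graph on $n$ nodes has diameter exactly $2$. -/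

import Mathlib

open Filter Asymptotics

/-- A two-argument machine `U p y`: a partial function of a binary program `p` and a natural
number `y` (natural numbers and binary strings being identified), whose output, if the
computation halts, is a binary string. It is *universal* if it is partial recursive (i.e.
computed by a Turing machine) and if every machine `V` can be simulated by `U`: each program `p`
for `V` is turned into a program `q` for `U` that computes the same partial function of `y` and
is longer by at most a constant depending only on `V` (for instance `q = ⟨i, p⟩ = 1^{l(i)} 0 i p`,
where `i` is an index of `V` in an enumeration of all Turing machines). -/
def IsUniversalMachine (U : List Bool → ℕ →. List Bool) : Prop :=
  Partrec₂ U ∧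
    ∀ V : List Bool → ℕ →. List Bool, Partrec₂ V →
      ∃ c : ℕ, ∀ p : List Bool, ∃ q : List Bool,
        q.length ≤ p.length + c ∧ ∀ y : ℕ, U q y = V p y

/-- The machine that on program `1^k 0 p` and input `y` runs the `k`-th partial recursive function
on `(p, y)`. -/
def unaryMachine (q : List Bool) (y : ℕ) : Part (List Bool) :=
  (Nat.Partrec.Code.eval (Denumerable.ofNat Nat.Partrec.Code (q.idxOf false))
    (Encodable.encode (q.drop (q.idxOf false + 1), y))).bind
      fun m => (Encodable.decode m : Option (List Bool))

/-- Universal machines exist. -/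
theorem isUniversalMachine_unaryMachine : IsUniversalMachine unaryMachine := by
  constructor
  · have h1 : Computable fun a : List Bool × ℕ => a.1.idxOf false :=
      (Primrec.list_idxOf.comp (Primrec.const false) Primrec.fst).to_comp
    have h2 : Computable fun a : List Bool × ℕ =>
        Denumerable.ofNat Nat.Partrec.Code (a.1.idxOf false) :=
      (Computable.ofNat Nat.Partrec.Code).comp h1
    have h3 : Computable fun a : List Bool × ℕ => a.1.drop (a.1.idxOf false + 1) :=
      (Primrec.list_drop.comp (Primrec.succ.comp
        (Primrec.list_idxOf.comp (Primrec.const false) Primrec.fst)) Primrec.fst).to_comp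
    have h4 : Computable fun a : List Bool × ℕ =>
        Encodable.encode (a.1.drop (a.1.idxOf false + 1), a.2) :=
      Computable.encode.comp (h3.pair Computable.snd)
    refine Partrec.bind (Nat.Partrec.Code.eval_part.comp h2 h4) ?_
    exact (Computable.ofOption Computable.decode).comp Computable.snd
  · intro V hV
    obtain ⟨c, hc⟩ := Nat.Partrec.Code.exists_code.1 hV
    refine ⟨Encodable.encode c + 1, fun p =>
      ⟨List.replicate (Encodable.encode c) true ++ false :: p, by simp; omega, fun y => ?_⟩⟩
    have e : ∀ k : ℕ, (List.replicate k true ++ false :: p).idxOf false = k := by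
      intro k
      induction k with
      | zero => simp
      | succ k ih => simp [List.replicate_succ, ih]
    have t : ∀ k : ℕ, (List.replicate k true ++ false :: p).drop (k + 1) = p := by
      intro k
      induction k with
      | zero => simp
      | succ k ih => simpa [List.replicate_succ] using ih
    unfold unaryMachine
    rw [e, t, Denumerable.ofNat_encode, hc]
    simp [Part.bind_map]

/-- Conditional Kolmogorov complexity `C(x | y)` with respect to the reference machine `U`: the
least length of a program that computes `x` on input `y`. (For universal `U` some such program
always exists.) -/
noncomputable def condComplexity (U : List Bool → ℕ →. List Bool) (x : List Bool) (y : ℕ) : ℕ :=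
  sInf {l : ℕ | ∃ p : List Bool, p.length = l ∧ x ∈ U p y}

open Classical in
/-- The string `E(G)` of length `n.choose 2`: its bits tell, for the pairs `i < j` in
lexicographic order, whether `ij` is an edge of `G`. -/
noncomputable def graphCode {n : ℕ} (G : SimpleGraph (Fin n)) : List Bool :=
  (List.finRange n).flatMap fun i =>
    ((List.finRange n).filter fun j => decide (i < j)).map fun j => decide (G.Adj i j)

/-- The labeled graph `G` on `n` nodes has randomness deficiency at most `d`:
`C(E(G) | n) ≥ n.choose 2 - d`. -/
def IsRandomGraph (U : List Bool → ℕ →. List Bool) {n : ℕ} (d : ℝ)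
    (G : SimpleGraph (Fin n)) : Prop :=
  (n.choose 2 : ℝ) - d ≤ (condComplexity U (graphCode G) n : ℝ)

/-- `P` is a family of paths of length `2` between `i` and `j`, any two of which are node-disjoint
apart from their common end nodes `i` and `j`. -/
def IsDisjointTwoPathFamily {V : Type*} (G : SimpleGraph V) (i j : V)
    (P : Finset (G.Walk i j)) : Prop :=
  (∀ p ∈ P, p.IsPath ∧ p.length = 2) ∧
    ∀ p ∈ P, ∀ q ∈ P, p ≠ q → ∀ v, v ∈ p.support → v ∈ q.support → v = i ∨ v = j

/-! Disjoint paths of length 2 between `i` and `j` correspond to common neighbours, so `r` is the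
codegree. In a uniformly random graph each of the other `n - 2` nodes is a common neighbour
independently with probability 1/4, so by Chernoff the codegree differs from `n/4` by more than
`n/q` with exponentially small probability; a union bound over pairs keeps it exponentially small up
to a factor `n²` (`card_isFar_codegree_le`).

Having such a deviation is decidable from the code, uniformly in `n`. A deviating graph is therefore
described, given `n`, by its rank among the deviating codes (`exists_condComplexity_le_size_card`).
This saves a number of bits linear in `n`, more than a deficiency `δ(n) = o(n)` permits for large
`n`. Diameter 2 follows: every codegree is positive and the graph is not complete. -/

/-! ### Exponential moments of the codegree -/

/-- Summing over all Boolean functions on `ι` a quantity that only depends on the values along an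
embedded copy of `κ`. -/
theorem sum_comp_injective {ι κ : Type*} [Fintype ι] [Fintype κ] [DecidableEq ι] [DecidableEq κ]
    (φ : κ → ι) (hφ : Function.Injective φ) (F : (κ → Bool) → ℝ) :
    ∑ f : ι → Bool, F (f ∘ φ) =
      2 ^ (Fintype.card ι - Fintype.card κ) * ∑ g : κ → Bool, F g := by
  classical
  let e : κ ⊕ ((Set.range φ)ᶜ : Set ι) ≃ ι :=
    ((Equiv.ofInjective φ hφ).sumCongr (Equiv.refl _)).trans (Equiv.Set.sumCompl (Set.range φ))
  have he : ∀ k, e (Sum.inl k) = φ k := fun k => by simp [e]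
  have hc : Fintype.card ((Set.range φ)ᶜ : Set ι) = Fintype.card ι - Fintype.card κ := by
    have := Fintype.card_congr e
    rw [Fintype.card_sum] at this
    omega
  let E : (ι → Bool) ≃ (κ → Bool) × (((Set.range φ)ᶜ : Set ι) → Bool) :=
    (e.arrowCongr (Equiv.refl Bool)).symm.trans (Equiv.sumArrowEquivProdArrow _ _ _)
  have hE : ∀ f, F (f ∘ φ) = F (E f).1 := fun f => by
    have : f ∘ φ = (E f).1 := by
      funext k
      simp [E, Equiv.sumArrowEquivProdArrow, he]
    rw [this]
  rw [Fintype.sum_equiv E (fun f => F (f ∘ φ)) (fun p => F p.1) hE, Fintype.sum_prod_type]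
  simp [hc, Finset.mul_sum]

theorem sum_prod_pairs {K : Type*} [Fintype K] [DecidableEq K] (w : Bool → Bool → ℝ) :
    ∑ g : K × Bool → Bool, ∏ k, w (g (k, false)) (g (k, true)) =
      (∑ a, ∑ b, w a b) ^ Fintype.card K := by
  rw [Fintype.sum_equiv (Equiv.curry K Bool Bool)
    (fun g => ∏ k, w (g (k, false)) (g (k, true))) (fun g => ∏ k, w (g k false) (g k true))
    (fun g => by simp)]
  have h := Finset.prod_univ_sum (fun _ : K => (Finset.univ : Finset (Bool → Bool)))
    (fun _ b => w (b false) (b true))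
  rw [Fintype.piFinset_univ] at h
  rw [← h, Finset.prod_const, Finset.card_univ]
  congr 1
  rw [Fintype.sum_equiv (Equiv.boolArrowEquivProd Bool) (fun b => w (b false) (b true))
    (fun p => w p.1 p.2) (fun b => by simp), Fintype.sum_prod_type]

open Classical in
/-- The number of common neighbours of `i` and `j`. -/
noncomputable def codegree {n : ℕ} (G : SimpleGraph (Fin n)) (i j : Fin n) : ℕ :=
  (Finset.univ.filter fun k => G.Adj i k ∧ G.Adj j k).card

-- The `2(n - 2)` pairs `ik`, `jk` are distinct, so their bits vary independently. For each `k`, the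
-- four values of its two bits contribute `1 + 1 + 1 + u`.
open Classical in
theorem sum_pow_codegree_le {n : ℕ} {i j : Fin n} (hij : i ≠ j) {u : ℝ} (hu : 0 < u) :
    ∑ G : SimpleGraph (Fin n), u ^ codegree G i j ≤
      2 ^ (n.choose 2 - 2 * (n - 2)) * (3 + u) ^ (n - 2) := by
  let ι := {e : Sym2 (Fin n) // ¬ e.IsDiag}
  let K := {k : Fin n // k ≠ i ∧ k ≠ j}
  let φ : K × Bool → ι := fun p => ⟨s(cond p.2 j i, p.1.1), by
    rcases p with ⟨⟨k, hk⟩, b⟩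
    cases b
    · simpa using hk.1.symm
    · simpa using hk.2.symm⟩
  have hφ : Function.Injective φ := by
    rintro ⟨⟨k, hk⟩, b⟩ ⟨⟨k', hk'⟩, b'⟩ h
    have h' : s(cond b j i, k) = s(cond b' j i, k') := congrArg Subtype.val h
    rw [Sym2.eq_iff] at h'
    cases b <;> cases b' <;> simp at h' <;> grind
  have hK : Fintype.card K = n - 2 := by
    have : (Finset.univ.filter fun k : Fin n => k ≠ i ∧ k ≠ j) = (Finset.univ.erase i).erase j := by
      ext k; simp [and_comm]
    rw [Fintype.card_subtype, this, Finset.card_erase_of_mem, Finset.card_erase_of_mem] <;>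
      simp [hij.symm]
    omega
  have hι : Fintype.card ι = n.choose 2 := by
    have := Sym2.card_subtype_not_diag (α := Fin n)
    rw [Fintype.card_fin] at this
    rw [← this]
  let w : Bool → Bool → ℝ := fun a b => if a && b then u else 1
  let F : (K × Bool → Bool) → ℝ := fun g => ∏ k, w (g (k, false)) (g (k, true))
  let Φ : SimpleGraph (Fin n) → ι → Bool := fun G e => decide (e.1 ∈ G.edgeSet)
  have hΦ : Function.Injective Φ := by
    intro G H h
    ext a b
    rcases eq_or_ne a b with rfl | hab
    · simp
    · have := congrFun h ⟨s(a, b), by simpa using hab⟩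
      simpa [Φ] using this
  have hF : ∀ G : SimpleGraph (Fin n), u ^ codegree G i j = F (Φ G ∘ φ) := by
    intro G
    have hw : ∀ k : K, w ((Φ G ∘ φ) (k, false)) ((Φ G ∘ φ) (k, true)) =
        if G.Adj i k ∧ G.Adj j k then u else 1 := fun k => by simp [w, Φ, φ]
    simp only [F, hw]
    rw [Finset.prod_ite, Finset.prod_const, Finset.prod_const_one, mul_one]
    congr 1
    unfold codegree
    symm
    refine Finset.card_bij (fun k _ => k.1) (by simp) (fun a _ b _ h => Subtype.ext h) ?_
    intro b hb
    simp only [Finset.mem_filter, Finset.mem_univ, true_and] at hb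
    exact ⟨⟨b, hb.1.ne', hb.2.ne'⟩, by simpa using hb, rfl⟩
  have hpos : ∀ f : ι → Bool, 0 ≤ F (f ∘ φ) := fun f =>
    Finset.prod_nonneg fun k _ => by simp only [w]; split_ifs <;> positivity
  calc ∑ G : SimpleGraph (Fin n), u ^ codegree G i j
      = ∑ G : SimpleGraph (Fin n), F (Φ G ∘ φ) := Finset.sum_congr rfl fun G _ => hF G
    _ = ∑ f ∈ Finset.univ.image Φ, F (f ∘ φ) := by
        rw [Finset.sum_image fun a _ b _ h => hΦ h]
    -- Injectivity of `Φ` suffices for an upper bound, since all terms are nonnegative.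
    _ ≤ ∑ f : ι → Bool, F (f ∘ φ) :=
        Finset.sum_le_sum_of_subset_of_nonneg (Finset.subset_univ _) fun f _ _ => hpos f
    _ = _ := by
        rw [sum_comp_injective φ hφ F, sum_prod_pairs, Fintype.card_prod, hι, hK, Fintype.card_bool,
          mul_comm (n - 2) 2]
        congr 2
        simp [w]
        ring

theorem two_mul_sub_two_le_choose {n : ℕ} (hn : 2 ≤ n) : 2 * (n - 2) ≤ n.choose 2 := by
  induction n, hn using Nat.le_induction with
  | base => simp
  | succ n hn ih =>
    rw [Nat.choose_succ_succ', Nat.choose_one_right, one_add_one_eq_two]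
    omega

/-! ### Chernoff bound -/

/-- A choice of the exponent in Chernoff's bound. -/
theorem exists_chernoff_exponent (s : ℝ) {η : ℝ} (hη : 0 < η) :
    ∃ l : ℝ, 0 < l ∧ (3 + Real.exp (s * l)) / 4 * Real.exp (-(l * (s / 4 + η))) < 1 := by
  -- At `l = 0` the function equals 1 and has slope `s/4 - (s/4 + η) = -η < 0`, so it drops below 1
  -- for some small positive `l`.
  have hd : HasDerivAt
      (fun l : ℝ => (3 + Real.exp (s * l)) / 4 * Real.exp (-(l * (s / 4 + η)))) (-η) 0 := by
    have h1 : HasDerivAt (fun l : ℝ => (3 + Real.exp (s * l)) / 4)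
        (Real.exp (s * 0) * (s * 1) / 4) 0 :=
      ((((hasDerivAt_id (0 : ℝ)).const_mul s).exp).const_add 3).div_const 4
    have h2 : HasDerivAt (fun l : ℝ => Real.exp (-(l * (s / 4 + η))))
        (Real.exp (-(0 * (s / 4 + η))) * (-(1 * (s / 4 + η)))) 0 :=
      (((hasDerivAt_id (0 : ℝ)).mul_const (s / 4 + η)).neg).exp
    refine (h1.mul h2).congr_deriv ?_
    norm_num
  have := (hasDerivAt_iff_tendsto_slope_zero.1 hd).mono_left
    (nhdsWithin_mono 0 (fun x (hx : x ∈ Set.Ioi (0 : ℝ)) => ne_of_gt hx))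
  have h3 := this.eventually (gt_mem_nhds (neg_lt_zero.2 hη))
  obtain ⟨l, hl, hl0⟩ := (h3.and self_mem_nhdsWithin).exists
  refine ⟨l, hl0, ?_⟩
  have hl0' : (0 : ℝ) < l := hl0
  simp only [zero_add, smul_eq_mul] at hl
  rw [inv_mul_lt_iff₀ hl0'] at hl
  norm_num at hl
  linarith

-- Markov's inequality for `exp (s * l * codegree)`. The cases `s = 1` and `s = -1` are the upper
-- and lower tails.
open Classical in
theorem card_deviating_codegree_le {s : ℝ} {η : ℝ} (hη : 0 < η) :
    ∃ A ρ : ℝ, 0 < A ∧ 0 < ρ ∧ ρ < 1 ∧ ∀ (n : ℕ) (i j : Fin n), i ≠ j →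
      ((Finset.univ.filter fun G : SimpleGraph (Fin n) =>
        η * n < s * (codegree G i j - n / 4)).card : ℝ) ≤ A * ρ ^ n * 2 ^ n.choose 2 := by
  obtain ⟨l, hl, hρ⟩ := exists_chernoff_exponent s hη
  set B : ℝ := (3 + Real.exp (s * l)) / 4 with hB
  have hB0 : 0 < B := by positivity
  set ρ := B * Real.exp (-(l * (s / 4 + η))) with hρd
  -- `B⁻¹ ^ 2` compensates for having `n - 2` rather than `n` factors `B`.
  refine ⟨(B⁻¹) ^ 2, ρ, by positivity, by positivity, hρ, fun n i j hij => ?_⟩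
  have hn : 2 ≤ n := by
    have := i.2; have := j.2; have : i.1 ≠ j.1 := fun h => hij (Fin.ext h); omega
  have h1 := sum_pow_codegree_le hij (Real.exp_pos (s * l))
  have h2 : ((Finset.univ.filter fun G : SimpleGraph (Fin n) =>
      η * n < s * (codegree G i j - n / 4)).card : ℝ) * Real.exp (l * (s / 4 + η) * n) ≤
      ∑ G : SimpleGraph (Fin n), Real.exp (s * l) ^ codegree G i j := by
    rw [← nsmul_eq_mul]
    refine le_trans (Finset.card_nsmul_le_sum _ (fun G => Real.exp (s * l) ^ codegree G i j) _ ?_)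
      (Finset.sum_le_sum_of_subset_of_nonneg (Finset.subset_univ _) fun _ _ _ => by positivity)
    intro G hG
    simp only [Finset.mem_filter, Finset.mem_univ, true_and] at hG
    rw [← Real.exp_nat_mul]
    apply Real.exp_le_exp.2
    nlinarith
  have h3 : (2 : ℝ) ^ (n.choose 2 - 2 * (n - 2)) * 4 ^ (n - 2) ≤ 2 ^ n.choose 2 := by
    have : (4 : ℝ) = 2 ^ 2 := by norm_num
    rw [this, ← pow_mul, ← pow_add]
    apply pow_le_pow_right₀ (by norm_num)
    have := two_mul_sub_two_le_choose hn
    omega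
  have h4 : (3 + Real.exp (s * l)) ^ (n - 2) = 4 ^ (n - 2) * (B ^ n * (B⁻¹) ^ 2) := by
    have : 3 + Real.exp (s * l) = 4 * B := by rw [hB]; ring
    obtain ⟨k, rfl⟩ := Nat.exists_eq_add_of_le' hn
    rw [this, mul_pow, Nat.add_sub_cancel, pow_add]
    field_simp
  have h5 : ρ ^ n = B ^ n * (Real.exp (l * (s / 4 + η) * n))⁻¹ := by
    rw [hρd, mul_pow, ← Real.exp_nat_mul, ← Real.exp_neg]
    congr 2
    ring
  rw [h5]
  have hE := Real.exp_pos (l * (s / 4 + η) * n)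
  have h6 := h2.trans h1
  rw [h4] at h6
  rw [← le_div_iff₀ hE] at h6
  refine h6.trans ?_
  rw [div_eq_mul_inv]
  have h7 := mul_le_mul_of_nonneg_right h3
    (by positivity : 0 ≤ (B ^ n * (B⁻¹) ^ 2) * (Real.exp (l * (s / 4 + η) * n))⁻¹)
  calc _ = _ := by ring
    _ ≤ _ := h7
    _ = _ := by ring

/-! ### Describing a string by its rank in a decidable set -/

theorem Primrec.nat_count {α : Type*} [Primcodable α] {p : α → ℕ → Bool} (hp : Primrec₂ p) :
    Primrec₂ fun a n => Nat.count (fun k => p a k = true) n := by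
  have h : Primrec₂ fun (a : α) (q : ℕ × ℕ) => q.2 + bif p a q.1 then 1 else 0 :=
    Primrec.nat_add.comp₂ (Primrec.snd.comp₂ Primrec₂.right)
      (Primrec.to₂ (Primrec.cond (hp.comp Primrec.fst (Primrec.fst.comp Primrec.snd))
        (Primrec.const 1) (Primrec.const 0)))
  refine (Primrec.nat_rec (Primrec.const 0) h).of_eq fun a n => ?_
  induction n with
  | zero => simp
  | succ n ih => simp only [ih, Nat.count_succ]; cases p a n <;> simp

/-- The natural number with a given little-endian binary expansion. -/
def bitsValue (p : List Bool) : ℕ := p.foldr Nat.bit 0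

theorem bitsValue_bits (k : ℕ) : bitsValue k.bits = k := by
  induction k using Nat.binaryRec' with
  | zero => simp [bitsValue]
  | bit b n h ih => rw [Nat.bits_append_bit n b h]; simpa [bitsValue] using congrArg (Nat.bit b) ih

theorem primrec_bitsValue : Primrec bitsValue := by
  have hb : Primrec₂ Nat.bit :=
    (Primrec.cond Primrec.fst (Primrec.nat_double_succ.comp Primrec.snd)
      (Primrec.nat_double.comp Primrec.snd)).of_eq fun x => by cases x.1 <;> simp [Nat.bit]
  exact Primrec.list_foldr (h := fun _ q => Nat.bit q.1 q.2) Primrec.id (Primrec.const 0)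
    ((hb.comp (Primrec.fst.comp Primrec.snd) (Primrec.snd.comp Primrec.snd)).to₂)

theorem condComplexity_le_of_mem {U : List Bool → ℕ →. List Bool} {x p : List Bool} {y : ℕ}
    (h : x ∈ U p y) : condComplexity U x y ≤ p.length :=
  Nat.sInf_le ⟨p, rfl, h⟩

/-- An element of a uniformly decidable family of finite sets of strings can be described by its
rank. -/
theorem exists_condComplexity_le_size_card {U : List Bool → ℕ →. List Bool}
    (hU : IsUniversalMachine U) {S : ℕ → List Bool → Bool} (hS : Primrec₂ S) :
    ∃ c : ℕ, ∀ (n : ℕ) (s : Finset (List Bool)), (∀ x, S n x = true → x ∈ s) →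
      ∀ x, S n x = true → condComplexity U x n ≤ Nat.size s.card + c := by
  classical
  -- `decode₂` accepts only genuine encodings, so each string of the family is counted once.
  let T : ℕ → ℕ → Bool := fun n e => ((Encodable.decode₂ (List Bool) e).map (S n)).getD false
  have hT : Primrec₂ T :=
    Primrec.option_getD.comp (Primrec.option_map (Primrec.decode₂.comp Primrec.snd)
      (hS.comp (Primrec.fst.comp Primrec.fst) Primrec.snd).to₂) (Primrec.const false)
  let R : List Bool × ℕ → ℕ → Bool := fun a t =>
    decide (Nat.count (fun e => T a.2 e = true) (t + 1) = bitsValue a.1 + 1)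
  have hR : Primrec₂ R := by
    refine PrimrecRel.decide (R := fun (a : List Bool × ℕ) (t : ℕ) =>
      Nat.count (fun e => T a.2 e = true) (t + 1) = bitsValue a.1 + 1) ?_
    exact Primrec.eq.comp₂ ((Primrec.nat_count hT).comp (Primrec.snd.comp Primrec.fst)
      (Primrec.succ.comp Primrec.snd)).to₂
      (Primrec.succ.comp (primrec_bitsValue.comp (Primrec.fst.comp Primrec.fst))).to₂
  -- The program is the rank in binary. `V` finds the first code at which the count of members
  -- reaches rank + 1; as `n` is an input, the simulation constant does not depend on it.
  let V : List Bool → ℕ →. List Bool := fun p y =>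
    (Nat.rfind fun t => Part.some (R (p, y) t)).bind
      fun t => ((Encodable.decode t : Option (List Bool)) : Part (List Bool))
  have hV : Partrec₂ V := by
    refine Partrec.bind (Partrec.rfind (p := fun a t => Part.some (R a t)) hR.to_comp.partrec₂) ?_
    exact (Computable.ofOption Computable.decode).comp Computable.snd
  obtain ⟨c, hc⟩ := hU.2 V hV
  refine ⟨c, fun n s hs x hx => ?_⟩
  have hTx : T n (Encodable.encode x) = true := by simp [T, hx]
  set k := Nat.count (fun e => T n e = true) (Encodable.encode x) with hk
  obtain ⟨q, hq, hqV⟩ := hc k.bits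
  have hxV : x ∈ V k.bits n := by
    refine Part.mem_bind_iff.2 ⟨Encodable.encode x, ?_, by simp⟩
    refine Nat.mem_rfind.2 ⟨?_, fun {m} hm => ?_⟩
    · simp only [Part.mem_some_iff, R, bitsValue_bits, eq_comm (a := true), decide_eq_true_eq]
      rw [Nat.count_succ, if_pos hTx]
    · simp only [Part.mem_some_iff, R, bitsValue_bits, eq_comm (a := false), decide_eq_false_iff_not]
      have := Nat.count_monotone (fun e => T n e = true) (Nat.succ_le_of_lt hm)
      rw [Nat.succ_eq_add_one] at this
      omega
  have hle : k ≤ s.card := by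
    rw [hk, Nat.count_eq_card_filter_range]
    refine (Finset.card_le_card (t := s.image Encodable.encode) ?_).trans Finset.card_image_le
    intro e he
    have he' := (Finset.mem_filter.1 he).2
    simp only [T] at he'
    cases hd : Encodable.decode₂ (List Bool) e with
    | none => simp [hd] at he'
    | some z =>
      simp only [hd, Option.map_some, Option.getD_some] at he'
      exact Finset.mem_image.2 ⟨z, hs z he', Encodable.mem_decode₂.1 hd⟩
  rw [← hqV n] at hxV
  have := condComplexity_le_of_mem hxV
  rw [Nat.size_eq_bits_len] at hq
  have := Nat.size_le_size hle
  omega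

/-! ### Paths of length 2 and diameter -/

theorem isGreatest_card_disjointTwoPathFamily {n : ℕ} (G : SimpleGraph (Fin n)) {i j : Fin n}
    (hij : i ≠ j) :
    IsGreatest {k : ℕ | ∃ P : Finset (G.Walk i j), IsDisjointTwoPathFamily G i j P ∧ P.card = k}
      (codegree G i j) := by
  classical
  constructor
  · let s := Finset.univ.filter fun k => G.Adj i k ∧ G.Adj j k
    let path : s → G.Walk i j := fun k =>
      .cons (Finset.mem_filter.1 k.2).2.1 (.cons (Finset.mem_filter.1 k.2).2.2.symm .nil)
    have hsupp : ∀ k, (path k).support = [i, k.1, j] := fun k => by simp [path]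
    have hinj : Function.Injective path := fun a b h => by
      have := congrArg SimpleGraph.Walk.support h
      rw [hsupp, hsupp] at this
      exact Subtype.ext (by simpa using this)
    refine ⟨Finset.univ.image path, ⟨?_, ?_⟩, ?_⟩
    · intro p hp
      obtain ⟨k, -, rfl⟩ := Finset.mem_image.1 hp
      have h := (Finset.mem_filter.1 k.2).2
      refine ⟨SimpleGraph.Walk.IsPath.mk' ?_, by simp [path]⟩
      rw [hsupp]
      simp [hij, h.1.ne, h.2.ne']
    · intro p hp q hq hpq v hvp hvq
      obtain ⟨k, -, rfl⟩ := Finset.mem_image.1 hp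
      obtain ⟨k', -, rfl⟩ := Finset.mem_image.1 hq
      rw [hsupp] at hvp hvq
      have hk : k.1 ≠ k'.1 := fun h => hpq (by rw [Subtype.ext h])
      simp only [List.mem_cons, List.not_mem_nil, or_false] at hvp hvq
      grind
    · rw [Finset.card_image_of_injective _ hinj, Finset.card_univ, Fintype.card_coe]
      rfl
  · rintro _ ⟨P, ⟨hP, hdisj⟩, rfl⟩
    have hmem : ∀ p ∈ P, G.Adj i (p.getVert 1) ∧ G.Adj j (p.getVert 1) := fun p hp => by
      have hl := (hP p hp).2
      have h0 := p.adj_getVert_succ (i := 0) (by omega)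
      have h1 := p.adj_getVert_succ (i := 1) (by omega)
      have h2 := p.getVert_length
      rw [hl] at h2
      rw [p.getVert_zero] at h0
      rw [h2] at h1
      exact ⟨h0, h1.symm⟩
    -- Disjointness makes the midpoint map injective: a shared midpoint would have to be `i` or `j`,
    -- to both of which it is adjacent.
    refine Finset.card_le_card_of_injOn (fun p => p.getVert 1) (fun p hp => ?_) ?_
    · simpa using hmem p hp
    · intro p hp q hq hpq
      by_contra hne
      have h := hmem p hp
      rcases hdisj p hp q hq hne _ (p.getVert_mem_support 1)
        (by rw [show p.getVert 1 = q.getVert 1 from hpq]; exact q.getVert_mem_support 1) with e | e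
      · exact h.1.ne e.symm
      · exact h.2.ne e.symm

theorem ediam_eq_two_of_codegree {n : ℕ} (hn : 2 ≤ n) {G : SimpleGraph (Fin n)} (hG : G ≠ ⊤)
    (h : ∀ i j : Fin n, i ≠ j → 0 < codegree G i j) : G.ediam = 2 := by
  classical
  have : Nontrivial (Fin n) := Fin.nontrivial_iff_two_le.2 hn
  apply le_antisymm
  · refine SimpleGraph.ediam_le_of_edist_le fun u v => ?_
    rcases eq_or_ne u v with rfl | huv
    · simp
    · obtain ⟨k, hk⟩ := Finset.card_pos.1 (h u v huv)
      have hk := (Finset.mem_filter.1 hk).2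
      simpa using SimpleGraph.edist_le
        (SimpleGraph.Walk.cons hk.1 (SimpleGraph.Walk.cons hk.2.symm SimpleGraph.Walk.nil))
  · have h0 : G.ediam ≠ 0 := SimpleGraph.ediam_ne_zero
    have h1 : G.ediam ≠ 1 := fun h => hG (SimpleGraph.ediam_eq_one.1 h)
    rw [← one_add_one_eq_two]
    exact Order.add_one_le_of_lt ((Order.one_le_iff_ne_zero.2 h0).lt_of_ne h1.symm)

theorem codegree_top {n : ℕ} {i j : Fin n} (hij : i ≠ j) :
    codegree (⊤ : SimpleGraph (Fin n)) i j = n - 2 := by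
  classical
  have : (Finset.univ.filter fun k : Fin n => (⊤ : SimpleGraph (Fin n)).Adj i k ∧
      (⊤ : SimpleGraph (Fin n)).Adj j k) = (Finset.univ.erase i).erase j := by
    ext k; simp [and_comm, eq_comm]
  have hcard : ((Finset.univ.erase i).erase j).card = n - 2 := by
    rw [Finset.card_erase_of_mem, Finset.card_erase_of_mem] <;> simp [hij.symm]
    omega
  rw [← hcard, ← this, codegree]
  congr

/-! ### Decidability of codegree deviation from the code -/

/-- The pairs `i < j < n` in lexicographic order. -/
def pairList (n : ℕ) : List (ℕ × ℕ) :=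
  (List.range n).flatMap fun i =>
    (List.range n).filterMap fun j => if i < j then some (i, j) else none

theorem mem_pairList {n : ℕ} {p : ℕ × ℕ} : p ∈ pairList n ↔ p.1 < p.2 ∧ p.2 < n := by
  rcases p with ⟨a, b⟩
  simp only [pairList, List.mem_flatMap, List.mem_range, List.mem_filterMap]
  constructor
  · rintro ⟨i, hi, j, hj, h⟩
    split_ifs at h
    simp only [Option.some.injEq, Prod.mk.injEq] at h
    omega
  · rintro ⟨h1, h2⟩
    exact ⟨a, h1.trans h2, b, h2, by simpa using h1⟩

theorem primrec_pairList : Primrec pairList := by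
  have h : Primrec fun p : ℕ × ℕ =>
      (List.range p.1).filterMap fun j => if p.2 < j then some (p.2, j) else none := by
    refine Primrec.listFilterMap (Primrec.list_range.comp Primrec.fst) ?_
    exact Primrec.ite (Primrec.nat_lt.comp (Primrec.snd.comp Primrec.fst) Primrec.snd)
      (Primrec.option_some.comp ((Primrec.snd.comp Primrec.fst).pair Primrec.snd))
      (Primrec.const none)
  exact Primrec.list_flatMap Primrec.list_range h

theorem graphCode_eq_map_pairList {n : ℕ} (G : SimpleGraph (Fin n)) (f : ℕ → ℕ → Bool)
    (hf : ∀ i j : Fin n, i < j → (f i j = true ↔ G.Adj i j)) :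
    graphCode G = (pairList n).map fun p => f p.1 p.2 := by
  classical
  have hr : List.range n = (List.finRange n).map Fin.val := by simp
  rw [graphCode, pairList, hr, List.flatMap_map, List.map_flatMap]
  congr 1
  funext i
  rw [List.filterMap_map, List.map_filterMap]
  generalize List.finRange n = l
  induction l with
  | nil => simp
  | cons j l ih =>
    by_cases hij : i < j
    · have := hf i j hij
      simp only [List.filter_cons, hij, decide_true, if_true, List.map_cons, ih,
        List.filterMap_cons, Function.comp, Fin.val_fin_lt, Option.map_some]
      congr 1
      rw [Bool.eq_iff_iff, this, decide_eq_true_eq]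
    · simpa [List.filter_cons, List.filterMap_cons, hij] using ih

/-- The bit for the pair `{i, j}` in the code `x` of a graph on `n` nodes. -/
def edgeBit (n : ℕ) (x : List Bool) (i j : ℕ) : Bool :=
  x.getD ((pairList n).idxOf (min i j, max i j)) false

theorem edgeBit_graphCode {n : ℕ} (G : SimpleGraph (Fin n)) (i j : Fin n) :
    edgeBit n (graphCode G) i j = true ↔ G.Adj i j := by
  classical
  let f : ℕ → ℕ → Bool := fun a b => decide (∃ (ha : a < n) (hb : b < n), G.Adj ⟨a, ha⟩ ⟨b, hb⟩)
  have hf : ∀ i j : Fin n, f i j = true ↔ G.Adj i j := fun i j => by simp [f]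
  have hcode := graphCode_eq_map_pairList G f fun i j _ => hf i j
  rcases eq_or_ne i j with rfl | hij
  -- A missing pair has index equal to the list length, so the lookup returns the default `false`:
  -- no loops.
  · have hnot : (i.1, i.1) ∉ pairList n := fun h => by simpa using (mem_pairList.1 h).1
    simp [edgeBit, hcode, List.idxOf_of_notMem hnot]
  · have hne : i.1 ≠ j.1 := fun h => hij (Fin.ext h)
    have hmem : (min i.1 j.1, max i.1 j.1) ∈ pairList n := mem_pairList.2 ⟨by grind, by grind⟩
    have hlt := List.idxOf_lt_length_of_mem hmem
    have : edgeBit n (graphCode G) i j = f (min i.1 j.1) (max i.1 j.1) := by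
      rw [edgeBit, hcode, List.getD_eq_getElem _ _ (by simpa using hlt), List.getElem_map,
        List.getElem_idxOf]
    rw [this]
    rcases le_total i.1 j.1 with h | h
    · rw [min_eq_left h, max_eq_right h, hf]
    · rw [min_eq_right h, max_eq_left h, hf, G.adj_comm]

theorem primrec_edgeBit {α : Type*} [Primcodable α] {n i j : α → ℕ} {x : α → List Bool}
    (hn : Primrec n) (hx : Primrec x) (hi : Primrec i) (hj : Primrec j) :
    Primrec fun a => edgeBit (n a) (x a) (i a) (j a) :=
  (Primrec.list_getD false).comp hx
    ((Primrec.list_idxOf.comp ((Primrec.nat_min.comp hi hj).pair (Primrec.nat_max.comp hi hj))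
      (primrec_pairList.comp hn)).of_eq fun _ => by
        congr 1; exact lawful_beq_subsingleton _ _)

/-- The number of common neighbours of `i` and `j`, computed from the code of the graph. -/
def codeCodegree (n : ℕ) (x : List Bool) (i j : ℕ) : ℕ :=
  Nat.count (fun k => (edgeBit n x i k && edgeBit n x j k) = true) n

theorem codeCodegree_graphCode {n : ℕ} (G : SimpleGraph (Fin n)) (i j : Fin n) :
    codeCodegree n (graphCode G) i j = codegree G i j := by
  classical
  rw [codeCodegree, Nat.count_eq_card_filter_range, codegree]
  symm
  refine Finset.card_bij (fun k _ => k.1) ?_ (fun a _ b _ h => Fin.ext h) ?_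
  · intro k hk
    simpa [edgeBit_graphCode] using hk
  · intro b hb
    rw [Finset.mem_filter, Finset.mem_range] at hb
    refine ⟨⟨b, hb.1⟩, ?_, rfl⟩
    have h := hb.2
    rw [Bool.and_eq_true] at h
    have h1 := edgeBit_graphCode G i ⟨b, hb.1⟩
    have h2 := edgeBit_graphCode G j ⟨b, hb.1⟩
    simpa using ⟨h1.1 h.1, h2.1 h.2⟩

theorem codegree_comm {n : ℕ} (G : SimpleGraph (Fin n)) (i j : Fin n) :
    codegree G i j = codegree G j i := by
  unfold codegree
  congr 1
  ext k
  simp [and_comm]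

/-- `c` differs from `n / 4` by more than `n / q`. -/
def IsFar (q n c : ℕ) : Prop := q * n + 4 * n < 4 * q * c ∨ 4 * q * c + 4 * n < q * n

instance (q n c : ℕ) : Decidable (IsFar q n c) := inferInstanceAs (Decidable (_ ∨ _))

/-- Multiplying by `4q` and moving negative terms across leaves a test in natural numbers, as
primitive recursion requires. -/
theorem isFar_iff {q n c : ℕ} (hq : 0 < q) :
    IsFar q n c ↔ (n : ℝ) / q < |(c : ℝ) - n / 4| := by
  have hq' : (0 : ℝ) < q := by exact_mod_cast hq
  rw [lt_abs, div_lt_iff₀ hq', div_lt_iff₀ hq', IsFar, ← Nat.cast_lt (α := ℝ),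
    ← Nat.cast_lt (α := ℝ)]
  push_cast
  constructor <;> rintro (h | h)
  · left; linarith
  · right; linarith
  · left; linarith
  · right; linarith

/-- `x` is the code of a graph on `n` nodes in which some codegree is far from `n / 4`. -/
def deviatingCode (q n : ℕ) (x : List Bool) : Bool :=
  decide (x = (pairList n).map fun p => edgeBit n x p.1 p.2) &&
    decide (∃ p ∈ pairList n, IsFar q n (codeCodegree n x p.1 p.2))

theorem primrec_deviatingCode (q : ℕ) : Primrec₂ (deviatingCode q) := by
  have hcode : Primrec fun a : (ℕ × ℕ) × (ℕ × List Bool) =>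
      codeCodegree a.2.1 a.2.2 a.1.1 a.1.2 := by
    refine (Primrec.nat_count (p := fun (a : (ℕ × ℕ) × (ℕ × List Bool)) k =>
      edgeBit a.2.1 a.2.2 a.1.1 k && edgeBit a.2.1 a.2.2 a.1.2 k) ?_).comp Primrec.id
      (Primrec.fst.comp Primrec.snd)
    have hn : Primrec fun b : ((ℕ × ℕ) × (ℕ × List Bool)) × ℕ => b.1.2.1 :=
      Primrec.fst.comp (Primrec.snd.comp Primrec.fst)
    have hx : Primrec fun b : ((ℕ × ℕ) × (ℕ × List Bool)) × ℕ => b.1.2.2 :=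
      Primrec.snd.comp (Primrec.snd.comp Primrec.fst)
    exact Primrec.and.comp
      (primrec_edgeBit hn hx (Primrec.fst.comp (Primrec.fst.comp Primrec.fst)) Primrec.snd)
      (primrec_edgeBit hn hx (Primrec.snd.comp (Primrec.fst.comp Primrec.fst)) Primrec.snd)
  have hn : Primrec fun a : (ℕ × ℕ) × (ℕ × List Bool) => a.2.1 :=
    Primrec.fst.comp Primrec.snd
  have hqn := Primrec.nat_mul.comp (Primrec.const q) hn
  have h4n := Primrec.nat_mul.comp (Primrec.const 4) hn
  have h4qc := Primrec.nat_mul.comp (Primrec.const (4 * q)) hcode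
  have hfar : PrimrecRel fun (p : ℕ × ℕ) (a : ℕ × List Bool) =>
      IsFar q a.1 (codeCodegree a.1 a.2 p.1 p.2) :=
    PrimrecPred.primrecRel (PrimrecPred.or
      (Primrec.nat_lt.comp (Primrec.nat_add.comp hqn h4n) h4qc)
      (Primrec.nat_lt.comp (Primrec.nat_add.comp h4qc h4n) hqn))
  have hex : PrimrecPred fun a : ℕ × List Bool =>
      ∃ p ∈ pairList a.1, IsFar q a.1 (codeCodegree a.1 a.2 p.1 p.2) :=
    hfar.exists_mem_list.comp (primrec_pairList.comp Primrec.fst) Primrec.id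
  have heq : PrimrecPred fun a : ℕ × List Bool =>
      a.2 = (pairList a.1).map fun p => edgeBit a.1 a.2 p.1 p.2 := by
    refine Primrec.eq.comp Primrec.snd (Primrec.list_map (primrec_pairList.comp Primrec.fst) ?_)
    exact Primrec.to₂ (primrec_edgeBit (Primrec.fst.comp Primrec.fst) (Primrec.snd.comp Primrec.fst)
      (Primrec.fst.comp Primrec.snd) (Primrec.snd.comp Primrec.snd))
  exact Primrec.and.comp heq.decide hex.decide

theorem deviatingCode_graphCode {q n : ℕ} (G : SimpleGraph (Fin n)) :
    deviatingCode q n (graphCode G) = true ↔ ∃ i j, i ≠ j ∧ IsFar q n (codegree G i j) := by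
  have hcode : graphCode G = (pairList n).map fun p => edgeBit n (graphCode G) p.1 p.2 :=
    graphCode_eq_map_pairList G (edgeBit n (graphCode G)) fun i j _ => edgeBit_graphCode G i j
  rw [deviatingCode, decide_eq_true hcode, Bool.true_and, decide_eq_true_eq]
  constructor
  · rintro ⟨⟨a, b⟩, hp, h⟩
    obtain ⟨hab, hb⟩ := mem_pairList.1 hp
    refine ⟨⟨a, hab.trans hb⟩, ⟨b, hb⟩, by simpa using hab.ne, ?_⟩
    rwa [← codeCodegree_graphCode]
  · rintro ⟨i, j, hij, h⟩
    rcases lt_or_gt_of_ne hij with hlt | hlt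
    · exact ⟨(i, j), mem_pairList.2 ⟨hlt, j.2⟩, by rwa [codeCodegree_graphCode]⟩
    · exact ⟨(j, i), mem_pairList.2 ⟨hlt, i.2⟩, by rwa [codeCodegree_graphCode, codegree_comm]⟩

/-- The first test in `deviatingCode` makes `x` a fixed point of reading bits and re-encoding, so
the graph read off from `x` has code `x`. Hence deviating codes are no more numerous than deviating
graphs. -/
theorem exists_graphCode_eq_of_deviatingCode {q n : ℕ} {x : List Bool}
    (h : deviatingCode q n x = true) : ∃ G : SimpleGraph (Fin n), graphCode G = x := by
  rw [deviatingCode, Bool.and_eq_true, decide_eq_true_eq] at h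
  let G : SimpleGraph (Fin n) :=
    { Adj := fun i j => i ≠ j ∧ edgeBit n x i j = true
      symm := ⟨fun i j hij => ⟨hij.1.symm, by
        rw [edgeBit, min_comm, max_comm]; exact hij.2⟩⟩
      loopless := ⟨fun i hi => hi.1 rfl⟩ }
  refine ⟨G, ?_⟩
  rw [graphCode_eq_map_pairList G (edgeBit n x) fun i j hij => by simp [G, hij.ne]]
  exact h.1.symm

/-! ### Union bound and incompressibility -/

open Classical in
theorem card_isFar_codegree_le {q : ℕ} (hq : 0 < q) :
    ∃ A ρ : ℝ, 0 < A ∧ 0 < ρ ∧ ρ < 1 ∧ ∀ n : ℕ,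
      ((Finset.univ.filter fun G : SimpleGraph (Fin n) =>
        ∃ i j, i ≠ j ∧ IsFar q n (codegree G i j)).card : ℝ) ≤
        A * ((n : ℝ) ^ 2 * ρ ^ n) * 2 ^ n.choose 2 := by
  have hη : (0 : ℝ) < 1 / q := by positivity
  obtain ⟨A, ρ, hA, hρ, hρ1, h⟩ := card_deviating_codegree_le (s := 1) hη
  obtain ⟨A', ρ', hA', hρ', hρ1', h'⟩ := card_deviating_codegree_le (s := -1) hη
  refine ⟨A + A', max ρ ρ', by positivity, lt_max_of_lt_left hρ, max_lt hρ1 hρ1', fun n => ?_⟩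
  let D : ℝ → Fin n × Fin n → Finset (SimpleGraph (Fin n)) := fun s p =>
    Finset.univ.filter fun G => 1 / (q : ℝ) * n < s * (codegree G p.1 p.2 - n / 4)
  let I : Finset (Fin n × Fin n) := Finset.univ.filter fun p => p.1 ≠ p.2
  have hI : (I.card : ℝ) ≤ (n : ℝ) ^ 2 := by
    have : I.card ≤ n * n := (Finset.card_le_univ _).trans (by simp)
    rw [sq]
    exact_mod_cast this
  have hsub : (Finset.univ.filter fun G : SimpleGraph (Fin n) =>
      ∃ i j, i ≠ j ∧ IsFar q n (codegree G i j)) ⊆ I.biUnion fun p => D 1 p ∪ D (-1) p := by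
    intro G hG
    obtain ⟨i, j, hij, hfar⟩ := (Finset.mem_filter.1 hG).2
    refine Finset.mem_biUnion.2 ⟨(i, j), by simpa [I] using hij, ?_⟩
    rw [isFar_iff hq, lt_abs] at hfar
    simp only [D, Finset.mem_union, Finset.mem_filter, Finset.mem_univ, true_and]
    refine hfar.imp (fun h => ?_) fun h => ?_
    · rw [one_mul, div_mul_eq_mul_div, one_mul]; exact h
    · rw [neg_one_mul, div_mul_eq_mul_div, one_mul]; exact h
  have hD : ∀ p ∈ I, ((D 1 p ∪ D (-1) p).card : ℝ) ≤
      (A + A') * max ρ ρ' ^ n * 2 ^ n.choose 2 := by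
    intro p hp
    have hp : p.1 ≠ p.2 := by simpa [I] using hp
    have h1 : A * ρ ^ n ≤ A * max ρ ρ' ^ n := by gcongr; exact le_max_left _ _
    have h2 : A' * ρ' ^ n ≤ A' * max ρ ρ' ^ n := by gcongr; exact le_max_right _ _
    calc ((D 1 p ∪ D (-1) p).card : ℝ) ≤ (D 1 p).card + (D (-1) p).card := by
          exact_mod_cast Finset.card_union_le _ _
      _ ≤ A * ρ ^ n * 2 ^ n.choose 2 + A' * ρ' ^ n * 2 ^ n.choose 2 :=
          add_le_add (h n p.1 p.2 hp) (h' n p.1 p.2 hp)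
      _ = (A * ρ ^ n + A' * ρ' ^ n) * 2 ^ n.choose 2 := by ring
      _ ≤ (A * max ρ ρ' ^ n + A' * max ρ ρ' ^ n) * 2 ^ n.choose 2 := by gcongr
      _ = _ := by ring
  calc _ ≤ ((I.biUnion fun p => D 1 p ∪ D (-1) p).card : ℝ) := by
        exact_mod_cast Finset.card_le_card hsub
    _ ≤ ∑ p ∈ I, ((D 1 p ∪ D (-1) p).card : ℝ) := by exact_mod_cast Finset.card_biUnion_le
    _ ≤ I.card * ((A + A') * max ρ ρ' ^ n * 2 ^ n.choose 2) := by
        rw [← nsmul_eq_mul]; exact Finset.sum_le_card_nsmul _ _ _ hD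
    _ ≤ (n : ℝ) ^ 2 * ((A + A') * max ρ ρ' ^ n * 2 ^ n.choose 2) := by gcongr
    _ = _ := by ring

theorem two_pow_size_le {N : ℕ} (hN : 0 < N) : 2 ^ Nat.size N ≤ 2 * N := by
  obtain ⟨k, hk⟩ := Nat.exists_eq_succ_of_ne_zero (Nat.size_pos.2 hN).ne'
  have : 2 ^ k ≤ N := Nat.lt_size.1 (by omega)
  rw [hk, pow_succ]
  omega

theorem tendsto_sq_mul_pow_mul_rpow {δ : ℕ → ℝ} (hδ : δ =o[atTop] (fun n : ℕ => (n : ℝ)))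
    {ρ : ℝ} (h0 : 0 < ρ) (h1 : ρ < 1) :
    Tendsto (fun n : ℕ => (n : ℝ) ^ 2 * ρ ^ n * (2 : ℝ) ^ δ n) atTop (nhds 0) := by
  -- Of the two factors in `ρ ^ n = σ ^ n * σ ^ n`, one absorbs `2 ^ δ n` and the other beats `n ^
  -- 2`.
  set σ := Real.sqrt ρ with hσ
  have hσ0 : 0 < σ := Real.sqrt_pos.2 h0
  have hσ1 : σ < 1 := by rw [hσ, Real.sqrt_lt' one_pos]; simpa using h1
  have hσσ : σ * σ = ρ := Real.mul_self_sqrt h0.le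
  have hθ : 0 < Real.logb 2 σ⁻¹ := Real.logb_pos (by norm_num) ((one_lt_inv₀ hσ0).2 hσ1)
  refine squeeze_zero' (Eventually.of_forall fun n => by positivity) ?_
    (tendsto_pow_const_mul_const_pow_of_lt_one 2 hσ0.le hσ1)
  filter_upwards [hδ.bound hθ] with n hn
  have hle : δ n ≤ Real.logb 2 σ⁻¹ * n := by
    refine (le_abs_self _).trans ?_
    simpa using hn
  have : (2 : ℝ) ^ δ n ≤ (σ⁻¹) ^ n := by
    refine (Real.rpow_le_rpow_of_exponent_le (by norm_num) hle).trans_eq ?_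
    rw [Real.rpow_mul (by norm_num), Real.rpow_logb (by norm_num) (by norm_num) (by positivity),
      Real.rpow_natCast]
  calc (n : ℝ) ^ 2 * ρ ^ n * (2 : ℝ) ^ δ n ≤ (n : ℝ) ^ 2 * ρ ^ n * (σ⁻¹) ^ n := by gcongr
    _ = (n : ℝ) ^ 2 * σ ^ n := by
        rw [mul_assoc, ← mul_pow, ← hσσ, mul_assoc, mul_inv_cancel₀ hσ0.ne', mul_one]

/-- A random deviating graph would force `2 ^ n.choose 2` to be at most `2 ^ δ n` times a constant
times the number of deviating graphs, which is eventually smaller than `2 ^ n.choose 2`. -/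
theorem eventually_codegree_near {U : List Bool → ℕ →. List Bool} (hU : IsUniversalMachine U)
    {δ : ℕ → ℝ} (hδ : δ =o[atTop] (fun n : ℕ => (n : ℝ))) {q : ℕ} (hq : 0 < q) :
    ∀ᶠ n : ℕ in atTop, ∀ G : SimpleGraph (Fin n), IsRandomGraph U (δ n) G →
      ∀ i j : Fin n, i ≠ j → |(codegree G i j : ℝ) - n / 4| ≤ n / q := by
  classical
  obtain ⟨c, hc⟩ := exists_condComplexity_le_size_card hU (primrec_deviatingCode q)
  obtain ⟨A, ρ, hA, hρ, hρ1, hcard⟩ := card_isFar_codegree_le hq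
  have hlim := (tendsto_sq_mul_pow_mul_rpow hδ hρ hρ1).const_mul ((2 : ℝ) ^ (c + 1) * A)
  rw [mul_zero] at hlim
  filter_upwards [hlim.eventually (gt_mem_nhds one_pos)] with n hn G hG i j hij
  by_contra hcon
  rw [not_le, ← isFar_iff hq] at hcon
  set B := Finset.univ.filter fun G : SimpleGraph (Fin n) =>
    ∃ i j, i ≠ j ∧ IsFar q n (codegree G i j) with hB
  have hmem : ∀ x, deviatingCode q n x = true → x ∈ B.image graphCode := by
    intro x hx
    obtain ⟨H, rfl⟩ := exists_graphCode_eq_of_deviatingCode hx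
    exact Finset.mem_image_of_mem _
      (Finset.mem_filter.2 ⟨Finset.mem_univ _, (deviatingCode_graphCode H).1 hx⟩)
  have hdev := (deviatingCode_graphCode G).2 ⟨i, j, hij, hcon⟩
  have hC := hc n _ hmem _ hdev
  set N := (B.image graphCode).card with hN
  have hN0 : 0 < N := Finset.card_pos.2 ⟨_, hmem _ hdev⟩
  have hNB : (N : ℝ) ≤ B.card := by exact_mod_cast Finset.card_image_le
  have hpow : (2 : ℝ) ^ condComplexity U (graphCode G) n ≤ 2 ^ (c + 1) * N := by
    calc (2 : ℝ) ^ condComplexity U (graphCode G) n ≤ 2 ^ (Nat.size N + c) :=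
          pow_le_pow_right₀ (by norm_num) hC
      _ = 2 ^ Nat.size N * 2 ^ c := pow_add _ _ _
      _ ≤ (2 * N) * 2 ^ c := by gcongr; exact_mod_cast two_pow_size_le hN0
      _ = _ := by ring
  have hrand : (2 : ℝ) ^ n.choose 2 ≤
      2 ^ condComplexity U (graphCode G) n * (2 : ℝ) ^ δ n := by
    rw [← Real.rpow_natCast, ← Real.rpow_natCast, ← Real.rpow_add (by norm_num)]
    apply Real.rpow_le_rpow_of_exponent_le (by norm_num)
    have := hG
    unfold IsRandomGraph at this
    linarith
  have hm : (0 : ℝ) < 2 ^ n.choose 2 := by positivity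
  have hfinal : (2 : ℝ) ^ n.choose 2 ≤
      (2 ^ (c + 1) * A * ((n : ℝ) ^ 2 * ρ ^ n * (2 : ℝ) ^ δ n)) * 2 ^ n.choose 2 := by
    calc (2 : ℝ) ^ n.choose 2 ≤ 2 ^ condComplexity U (graphCode G) n * (2 : ℝ) ^ δ n := hrand
      _ ≤ (2 ^ (c + 1) * (A * ((n : ℝ) ^ 2 * ρ ^ n) * 2 ^ n.choose 2)) * (2 : ℝ) ^ δ n := by
          gcongr
          exact hpow.trans (by gcongr; exact hNB.trans (hcard n))
      _ = _ := by ring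
  have := mul_lt_mul_of_pos_right hn hm
  linarith

theorem mainTheorem5 (U : List Bool → ℕ →. List Bool) (hU : IsUniversalMachine U)
    (δ : ℕ → ℝ) (hδ : δ =o[atTop] (fun n : ℕ => (n : ℝ))) :
    (∃ ε : ℕ → ℝ, ε =o[atTop] (fun n : ℕ => (n : ℝ)) ∧
      ∀ (n : ℕ) (G : SimpleGraph (Fin n)), IsRandomGraph U (δ n) G →
        ∀ i j : Fin n, i ≠ j →
          ∃ r : ℕ,
            IsGreatest {k : ℕ | ∃ P : Finset (G.Walk i j),
              IsDisjointTwoPathFamily G i j P ∧ P.card = k} r ∧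
            |(r : ℝ) - (n : ℝ) / 4| ≤ ε n) ∧
    (∃ N : ℕ, ∀ (n : ℕ), N ≤ n → ∀ G : SimpleGraph (Fin n), IsRandomGraph U (δ n) G →
      G.ediam = 2) := by
  constructor
  -- `ε n` is the worst deviation over random graphs and pairs: a supremum over a finite type, equal
  -- to 0 if that type is empty.
  · let dev : (n : ℕ) → {p : SimpleGraph (Fin n) × Fin n × Fin n //
        IsRandomGraph U (δ n) p.1 ∧ p.2.1 ≠ p.2.2} → ℝ :=
      fun n p => |(codegree p.1.1 p.1.2.1 p.1.2.2 : ℝ) - n / 4|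
    refine ⟨fun n => ⨆ p, dev n p, ?_, fun n G hG i j hij =>
      ⟨codegree G i j, isGreatest_card_disjointTwoPathFamily G hij,
        le_ciSup (f := dev n) (Set.finite_range _).bddAbove ⟨(G, i, j), hG, hij⟩⟩⟩
    refine isLittleO_iff.2 fun η hη => ?_
    obtain ⟨q, hq⟩ := exists_nat_gt (1 / η)
    have hq0 : 0 < q := by
      have : (0 : ℝ) < q := (by positivity : 0 < 1 / η).trans hq
      exact_mod_cast this
    filter_upwards [eventually_codegree_near hU hδ hq0] with n hn
    rw [Real.norm_of_nonneg (Real.iSup_nonneg fun p => abs_nonneg _), Real.norm_natCast]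
    refine Real.iSup_le (fun p => ?_) (by positivity)
    refine (hn p.1.1 p.2.1 _ _ p.2.2).trans ?_
    rw [div_eq_inv_mul]
    gcongr
    rw [inv_le_comm₀ (by exact_mod_cast hq0) hη, ← one_div]
    exact hq.le
  -- With `q = 8` codegrees lie between `n/8` and `3n/8`. The lower bound is positive, and the upper
  -- one excludes the complete graph, as `n - 2 > 3n/8` for `n ≥ 6`.
  · obtain ⟨N, hN⟩ := eventually_atTop.1 (eventually_codegree_near hU hδ (q := 8) (by norm_num))
    refine ⟨max N 6, fun n hn G hG => ?_⟩
    have h6 : 6 ≤ n := (le_max_right _ _).trans hn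
    have h6' : (6 : ℝ) ≤ n := by exact_mod_cast h6
    have hnear := hN n ((le_max_left _ _).trans hn) G hG
    refine ediam_eq_two_of_codegree (by omega) ?_ fun i j hij => ?_
    · rintro rfl
      have hij : (⟨0, by omega⟩ : Fin n) ≠ ⟨1, by omega⟩ := by simp
      have := hnear _ _ hij
      rw [codegree_top hij, abs_le, Nat.cast_sub (by omega)] at this
      push_cast at this
      linarith [this.2]
    · have := (abs_le.1 (hnear i j hij)).1
      push_cast at this
      have : (0 : ℝ) < codegree G i j := by linarith
      exact_mod_cast this
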